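/- Let $\bar t>0$ and $p>0$. For real $f\in L^2(-\pi,\pi)$ let $\hat f(n)=\frac1{2\pi}\int_{-\pi}^{\pi}f(x)e^{-inx}\,dx$, and let $T:L^2(-\pi,\pi)\to L^1(-\pi,\pi)$ be the forward operator of the periodic backwards heat equation, $$(Tf)(x)=\sum_{n\in\mathbb Z}e^{-n^2\bar t}\hat f(n)e^{inx}.$$ Let $H^p$ be the periodic Sobolev space of all $f\in L^2(-\pi,\pi)$ with $\sum_{n}(1+n^2)^p|\hat f(n)|^2<\infty$. For $f^\dagger\in H^p$ put $g^\dagger=Tf^\dagger$. A noise function $\xi\in L^1(-\pi,\pi)$ is said to satisfy the noise model with parameters $\varepsilon,\eta\ge0$ if there is a Borel set $S\subset(-\pi,\pi)$ with $|S|\le\eta$ and $\|\xi\|_{L^1((-\pi,\pi)\setminus S)}\le\varepsilon$. For $\alpha>0$ let $\hat f_\alpha$ be any minimizer over $f\in L^2(-\pi,\pi)$ of $$\frac1\alpha\|Tf-(g^\dagger+\xi)\|_{L^1}+\|f\|_{L^2}^2 .$$ Put $$\gamma(\delta)=\frac{8\max\{1,\bar t^{-1/2}\}}{e^{3\bar t}-1}\exp\Bigl(-\Bigl\lfloor\frac{\pi}{\delta}-\frac12\Bigr\rfloor^2\bar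 t\Bigr),$$ and consider, for a constant $C_e>0$, the condition $$\sqrt{\frac{2\varepsilon}{\alpha}}+\frac{2\eta\,\gamma(2\eta)}{\alpha}\le C_e.\qquad(*)$$ (1) For every $f^\dagger\in H^p$ there are $\eta_0>0$ and a constant $C>0$, depending only on $\bar t$, $p$ and $f^\dagger$, such that for every $C_e>0$, for all $0<\eta\le\eta_0$, $\varepsilon\ge0$, $0<\alpha<1$ satisfying $(*)$, for all $\xi$ satisfying the noise model and all minimizers $\hat f_\alpha$, $$\|\hat f_\alpha-f^\dagger\|_{L^2}^2\le C\Bigl(\frac{\varepsilon}{\alpha}+\frac{\eta^2}{\alpha^2}\exp\Bigl(-\frac{\pi^2}{8\eta^2}\bar t\Bigr)+(-\ln\alpha)^{-p}\Bigr)(1+o(1)),$$ $$\|T\hat f_\alpha-g^\dagger\|_{L^1}\le C\Bigl(\varepsilon+\frac{\eta^2}{\alpha}\exp\Bigl(-\frac{\pi^2}{8\eta^2}\bar t\Bigr)+\alpha(-\ln\alpha)^{-p}\Bigr)(1+o(1))$$ as $\eta,\varepsilon,\alpha\searrow0$, where the terms $o(1)$ are functions of $(\eta,\varepsilon,\alpha)$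 that may depend on $C_e$ but not on $\xi$ or $\hat f_\alpha$. (2) There is a parameter choice $\bar\alpha=\bar\alpha(\varepsilon,\eta)$, depending besides $\varepsilon,\eta$ only on $\bar t$ and $p$, with $\bar\alpha>0$ and $(*)$ (for some constant $C_e$) for all sufficiently small $\varepsilon\ge0$, $\eta>0$, and $\bar\alpha\to0$ as $\varepsilon,\eta\searrow0$, such that for every $f^\dagger\in H^p$ $$\|\hat f_{\bar\alpha}-f^\dagger\|_{L^2}^2=\mathcal O\bigl(\max\{(-\ln\varepsilon)^{-p},\eta^{2p}\}\bigr),$$ $$\|T\hat f_{\bar\alpha}-g^\dagger\|_{L^1}=\mathcal O\Bigl(\max\Bigl\{\varepsilon,\exp\Bigl(-\frac{\pi^2}{16\eta^2}\bar t\Bigr)\eta^{2p+1}\Bigr\}\Bigr)$$ as $\varepsilon,\eta\searrow0$, uniformly over all $\xi$ satisfying the noise model and all minimizers $\hat f_{\bar\alpha}$; here $(-\ln\varepsilon)^{-p}:=0$ for $\varepsilon=0$. -/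

import Mathlib

open MeasureTheory Filter Topology

noncomputable section

namespace HeatL1

/-- Lebesgue measure on the interval `(-π, π)`. -/
abbrev circleMeasure : Measure ℝ := volume.restrict (Set.Ioo (-Real.pi) Real.pi)

/-- The real Hilbert space `L²(-π, π)`. -/
abbrev L2 : Type := Lp ℝ 2 circleMeasure

/-- The real Banach space `L¹(-π, π)`. -/
abbrev L1 : Type := Lp ℝ 1 circleMeasure

/-- The Fourier coefficient `(2π)⁻¹ ∫_{-π}^{π} f(x) exp(-i n x) dx`. -/
def coeff (f : L2) (n : ℤ) : ℂ :=
  fourierCoeffOn (neg_lt_self Real.pi_pos) (fun x : ℝ => ((f x : ℝ) : ℂ)) n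

theorem coeff_eq (f : L2) (n : ℤ) :
    coeff f n = (1 / (2 * Real.pi) : ℝ) •
      ∫ x in (-Real.pi)..Real.pi, Complex.exp (-(Complex.I * n * x)) * ((f x : ℝ) : ℂ) := by
  have h2 : Real.pi - -Real.pi = 2 * Real.pi := by ring
  have hpi : (Real.pi : ℂ) ≠ 0 := by exact_mod_cast Real.pi_ne_zero
  rw [coeff, fourierCoeffOn_eq_integral, h2]
  congr 1
  apply intervalIntegral.integral_congr
  intro x _
  simp only [fourier_coe_apply, smul_eq_mul]
  congr 2
  push_cast
  field_simp

/-- Membership in the (periodic) Sobolev space `H^p` of order `p` on the circle: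
`∑ₙ (1 + n²)^p |f̂(n)|² < ∞`. -/
def MemSobolev (p : ℝ) (f : L2) : Prop :=
  Summable fun n : ℤ => (1 + (n : ℝ) ^ 2) ^ p * ‖coeff f n‖ ^ 2

/-- The `n`-th term `exp(-n² t) f̂(n) exp(i n x)` of the Fourier series of the heat flow. -/
def heatTerm (t : ℝ) (f : L2) (n : ℤ) (x : ℝ) : ℂ :=
  (Real.exp (-(n : ℝ) ^ 2 * t) : ℂ) * coeff f n * Complex.exp (Complex.I * n * x)

/-- The solution at time `t` of the periodic heat equation with initial value `f`,
`∑ₙ exp(-n² t) f̂(n) exp(i n x)`. -/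
def heatSeries (t : ℝ) (f : L2) (x : ℝ) : ℂ := ∑' n : ℤ, heatTerm t f n x

theorem norm_coeff_le (f : L2) : ∃ B : ℝ, ∀ n : ℤ, ‖coeff f n‖ ≤ B := by
  refine ⟨‖(1 / (2 * Real.pi) : ℝ)‖ * ∫ x in (-Real.pi)..Real.pi, |f x|, fun n => ?_⟩
  rw [coeff_eq, norm_smul]
  gcongr
  refine (intervalIntegral.norm_integral_le_integral_norm
    (neg_lt_self Real.pi_pos).le).trans (le_of_eq ?_)
  apply intervalIntegral.integral_congr
  intro x _
  have : -(Complex.I * n * x) = ((-(n * x) : ℝ) : ℂ) * Complex.I := by push_cast; ring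
  simp only [norm_mul, this, Complex.norm_exp_ofReal_mul_I, one_mul, Complex.norm_real,
    Real.norm_eq_abs]

theorem summable_gauss {t : ℝ} (ht : 0 < t) :
    Summable fun n : ℤ => Real.exp (-(n : ℝ) ^ 2 * t) := by
  have key : Summable fun n : ℕ => Real.exp (-(n : ℝ) ^ 2 * t) := by
    refine Summable.of_nonneg_of_le (fun n => (Real.exp_pos _).le) (fun n => ?_)
      (Real.summable_exp_nat_mul_iff.mpr (neg_neg_of_pos ht))
    apply Real.exp_le_exp.mpr
    have h : (n : ℝ) ≤ (n : ℝ) ^ 2 := by exact_mod_cast Nat.le_self_pow two_ne_zero n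
    nlinarith
  refine Summable.of_nat_of_neg (by simpa using key) (by simpa using key)

theorem norm_heatTerm (t : ℝ) (f : L2) (n : ℤ) (x : ℝ) :
    ‖heatTerm t f n x‖ = Real.exp (-(n : ℝ) ^ 2 * t) * ‖coeff f n‖ := by
  have : Complex.I * n * x = ((n * x : ℝ) : ℂ) * Complex.I := by push_cast; ring
  rw [heatTerm, norm_mul, norm_mul, this, Complex.norm_exp_ofReal_mul_I, mul_one,
    Complex.norm_real, Real.norm_of_nonneg (Real.exp_pos _).le]

theorem summable_bound {t : ℝ} (ht : 0 < t) (f : L2) :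
    Summable fun n : ℤ => Real.exp (-(n : ℝ) ^ 2 * t) * ‖coeff f n‖ := by
  obtain ⟨B, hB⟩ := norm_coeff_le f
  refine Summable.of_nonneg_of_le (fun n => by positivity) (fun n => ?_)
    ((summable_gauss ht).mul_right B)
  exact mul_le_mul_of_nonneg_left (hB n) (Real.exp_pos _).le

theorem summable_heatTerm {t : ℝ} (ht : 0 < t) (f : L2) (x : ℝ) :
    Summable fun n : ℤ => heatTerm t f n x :=
  Summable.of_norm (by simpa only [norm_heatTerm] using summable_bound ht f)

theorem continuous_heatSeries {t : ℝ} (ht : 0 < t) (f : L2) : Continuous (heatSeries t f) := by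
  refine continuous_tsum (fun n => ?_) (summable_bound ht f)
    (fun n x => (norm_heatTerm t f n x).le)
  unfold heatTerm
  fun_prop

theorem coeff_neg (f : L2) (n : ℤ) : coeff f (-n) = (starRingEnd ℂ) (coeff f n) := by
  rw [coeff_eq, coeff_eq, Complex.real_smul, Complex.real_smul, map_mul, Complex.conj_ofReal,
    intervalIntegral.integral_of_le (neg_lt_self Real.pi_pos).le,
    intervalIntegral.integral_of_le (neg_lt_self Real.pi_pos).le, ← integral_conj]
  congr 1
  refine integral_congr_ae (ae_of_all _ fun x => ?_)
  simp [← Complex.exp_conj]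

/-- The heat flow of a real initial value is real. -/
theorem ofReal_re_heatSeries (t : ℝ) (f : L2) (x : ℝ) :
    (((heatSeries t f x).re : ℝ) : ℂ) = heatSeries t f x := by
  rw [← Complex.conj_eq_iff_re, heatSeries, Complex.conj_tsum,
    ← (Equiv.neg ℤ).tsum_eq]
  refine tsum_congr fun n => ?_
  simp [heatTerm, coeff_neg, ← Complex.exp_conj, Complex.conj_ofReal]

theorem memLp_heatSeries {t : ℝ} (ht : 0 < t) (f : L2) :
    MemLp (fun x => (heatSeries t f x).re) 1 circleMeasure := by
  refine MemLp.of_bound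
    (Complex.continuous_re.comp (continuous_heatSeries ht f)).aestronglyMeasurable
    (∑' n : ℤ, Real.exp (-(n : ℝ) ^ 2 * t) * ‖coeff f n‖) (ae_of_all _ fun x => ?_)
  refine (Complex.abs_re_le_norm _).trans ?_
  refine (norm_tsum_le_tsum_norm ?_).trans (le_of_eq ?_)
  · simpa only [norm_heatTerm] using summable_bound ht f
  · simp only [norm_heatTerm]

/-- The forward operator `T : L²(-π, π) → L¹(-π, π)` of the backwards heat equation at
time `t > 0`, `(T f)(x) = ∑ₙ exp(-n² t) f̂(n) exp(i n x)`; the series is real, see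
`ofReal_re_heatSeries`. -/
def heatOp (t : ℝ) (ht : 0 < t) (f : L2) : L1 := (memLp_heatSeries ht f).toLp _

/-- The impulsive noise model: outside a Borel set of measure at most `η`, the
`L¹`-norm of the noise `ξ` is at most `ε`. -/
def IsImpulsive (ε η : ℝ) (ξ : L1) : Prop :=
  ∃ S : Set ℝ, MeasurableSet S ∧ S ⊆ Set.Ioo (-Real.pi) Real.pi ∧
    volume S ≤ ENNReal.ofReal η ∧
    ∫ x in Set.Ioo (-Real.pi) Real.pi \ S, |ξ x| ≤ ε

/-- The `L¹`-Tikhonov functional `f ↦ α⁻¹ ‖T f - g‖_{L¹} + ‖f‖²_{L²}` for data `g`. -/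
def tikhonov (t : ℝ) (ht : 0 < t) (α : ℝ) (g : L1) (f : L2) : ℝ :=
  1 / α * ‖heatOp t ht f - g‖ + ‖f‖ ^ 2

/-- `f` minimizes the `L¹`-Tikhonov functional for data `g` over all of `L²(-π, π)`. -/
def IsTikhonovMin (t : ℝ) (ht : 0 < t) (α : ℝ) (g : L1) (f : L2) : Prop :=
  ∀ h : L2, tikhonov t ht α g f ≤ tikhonov t ht α g h

/-- The function `γ` for which the heat operator satisfies the interpolation inequality
`‖T f - T f₀‖_{L^∞} ≤ γ(δ) ‖f - f₀‖_{L²} + δ⁻¹ ‖T f - T f₀‖_{L¹}` for small `δ > 0`. -/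
def gammaHeat (t δ : ℝ) : ℝ :=
  8 * max 1 (t ^ (-(1 / 2) : ℝ)) / (Real.exp (3 * t) - 1) *
    Real.exp (-((⌊Real.pi / δ - 1 / 2⌋ : ℤ) : ℝ) ^ 2 * t)

/-- The condition `√(2ε/α) + 2ηγ(2η)/α ≤ Cₑ` on the regularization parameter `α`. -/
def ParamCond (t Ce ε η α : ℝ) : Prop :=
  Real.sqrt (2 * ε / α) + 2 * η * gammaHeat t (2 * η) / α ≤ Ce

end HeatL1

end

open HeatL1

open MeasureTheory Filter Topology

namespace HeatL1

/-! ### Fourier coefficients on `L²(-π, π)` -/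

/-! Write `h = fα - f†` and `X = ‖T h‖` in `L¹`. Everything rests on `2π e^{-n²t} |ĥ(n)| ≤ X`
(`exp_mul_norm_coeff_le`), used with two different frequency cut-offs.

Noise: on the corrupted set `S` nothing is known about `ξ`, so `T h` itself must be small there.
Cutting its Fourier series at `N` gives `‖T h‖_∞ ≤ (2N+1)/(2π) X + (Gaussian tail) ‖h‖`. With `N ≈
π/(3η)` the first term costs at most two thirds of `X` after integration over `S`, so one third of
`X` survives (`IsImpulsive.norm_heatOp_le`).

Smoothness: the minimality of `fα` leaves the cross term `-2⟨f†, h⟩`. Frequencies below about `(-log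
α / 4t)^{1/2}` are controlled by `X`, the others by the decay of the coefficients of `f†` together
with a small multiple of `‖h‖²`; this yields the remainder `(-log α)^{-p}`
(`MemSobolev.exists_inner_le`).

Adding the two estimates gives `MemSobolev.exists_error_bound`. The squared tail is of order
`exp(-π²t/(6η²))` up to lower-order exponents. It beats the required `exp(-π²t/(8η²))` by enough to
produce an extra factor `η^{2p}` (`exists_exp_sq_le`). Part (1) discards this factor. Part (2)
relies on it: `α ≥ η exp(-π²t/(16η²))` then bounds the middle term by `η^{2p}`, while `α ≥ ε (-log
ε)^p` bounds `ε/α` by `(-log ε)^{-p}`. -/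

theorem integral_circle_eq {E : Type*} [NormedAddCommGroup E] [NormedSpace ℝ E] (u : ℝ → E) :
    ∫ x in (-Real.pi)..Real.pi, u x = ∫ x, u x ∂circleMeasure := by
  rw [intervalIntegral.integral_of_le (neg_lt_self Real.pi_pos).le, integral_Ioc_eq_integral_Ioo]

theorem coeff_eq_integral (f : L2) (n : ℤ) :
    coeff f n = (1 / (2 * Real.pi) : ℝ) •
      ∫ x, Complex.exp (-(Complex.I * n * x)) * ((f x : ℝ) : ℂ) ∂circleMeasure := by
  rw [coeff_eq, integral_circle_eq]

theorem norm_exp_neg_I_mul (n : ℤ) (x : ℝ) : ‖Complex.exp (-(Complex.I * n * x))‖ = 1 := by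
  have : -(Complex.I * n * x) = ((-(n * x) : ℝ) : ℂ) * Complex.I := by push_cast; ring
  rw [this, Complex.norm_exp_ofReal_mul_I]

theorem integrable_exp_mul {u : ℝ → ℂ} (hu : Integrable u circleMeasure) (n : ℤ) :
    Integrable (fun x : ℝ => Complex.exp (-(Complex.I * n * x)) * u x) circleMeasure := by
  refine hu.bdd_mul (c := 1) (Continuous.aestronglyMeasurable (by fun_prop)) (ae_of_all _ fun x => ?_)
  rw [norm_exp_neg_I_mul]

theorem integrable_coe_L2 (f : L2) : Integrable (fun x => f x) circleMeasure :=
  (Lp.memLp f).integrable one_le_two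

theorem coeff_add (f g : L2) (n : ℤ) : coeff (f + g) n = coeff f n + coeff g n := by
  have h := integral_add (integrable_exp_mul (integrable_coe_L2 f).ofReal n)
    (integrable_exp_mul (integrable_coe_L2 g).ofReal n)
  rw [coeff_eq_integral, coeff_eq_integral, coeff_eq_integral, ← smul_add]
  refine congrArg _ (Eq.trans (integral_congr_ae ?_) h)
  filter_upwards [Lp.coeFn_add f g] with x hx
  simp only [hx, Pi.add_apply, Complex.ofReal_add, mul_add]
  rfl

theorem coeff_sub (f g : L2) (n : ℤ) : coeff (f - g) n = coeff f n - coeff g n := by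
  rw [eq_sub_iff_add_eq, ← coeff_add, sub_add_cancel]

theorem norm_sq_eq_integral (f : L2) : ‖f‖ ^ 2 = ∫ x, f x ^ 2 ∂circleMeasure := by
  rw [← real_inner_self_eq_norm_sq, L2.inner_def]
  refine integral_congr_ae (ae_of_all _ fun x => ?_)
  simp

/-- Parseval's identity. -/
theorem hasSum_norm_coeff_sq (f : L2) :
    HasSum (fun n : ℤ => 2 * Real.pi * ‖coeff f n‖ ^ 2) (‖f‖ ^ 2) := by
  have hf : MemLp (fun x : ℝ => ((f x : ℝ) : ℂ)) 2
      (volume.restrict (Set.Ioc (-Real.pi) Real.pi)) := by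
    rw [← restrict_Ioo_eq_restrict_Ioc]
    exact (Lp.memLp f).ofReal
  have h := (hasSum_sq_fourierCoeffOn (neg_lt_self Real.pi_pos) hf).mul_left (2 * Real.pi)
  rw [integral_circle_eq] at h
  rw [smul_eq_mul, ← mul_assoc, sub_neg_eq_add, ← two_mul,
    mul_inv_cancel₀ (by positivity), one_mul] at h
  simpa only [norm_sq_eq_integral, coeff, Complex.norm_real, Real.norm_eq_abs, sq_abs] using h

theorem norm_coeff_le_norm (f : L2) (n : ℤ) : ‖coeff f n‖ ≤ ‖f‖ := by
  have h : 2 * Real.pi * ‖coeff f n‖ ^ 2 ≤ ‖f‖ ^ 2 :=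
    le_hasSum (hasSum_norm_coeff_sq f) n fun m _ => by positivity
  refine le_of_sq_le_sq ?_ (norm_nonneg f)
  nlinarith [Real.pi_gt_three, sq_nonneg ‖coeff f n‖]

/-- Polarization of Parseval's identity, with `ℂ` regarded as a real inner product space. -/
theorem hasSum_inner_coeff (f g : L2) :
    HasSum (fun n : ℤ => 2 * Real.pi * inner ℝ (coeff f n) (coeff g n)) (inner ℝ f g) := by
  have h := ((hasSum_norm_coeff_sq (f + g)).sub (hasSum_norm_coeff_sq (f - g))).div_const 4
  have h1 : (‖f + g‖ ^ 2 - ‖f - g‖ ^ 2) / 4 = inner ℝ f g := by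
    rw [norm_add_sq_real, norm_sub_sq_real]
    ring
  rw [h1] at h
  refine h.congr_fun fun n => ?_
  rw [coeff_add, coeff_sub, norm_add_sq_real, norm_sub_sq_real]
  ring

/-- The scalar product is dominated by the absolute Fourier coefficients. -/
theorem abs_inner_le_of_hasSum {f g : L2} {u : ℤ → ℝ} {s : ℝ} (hu : HasSum u s)
    (h : ∀ n, 2 * Real.pi * (‖coeff f n‖ * ‖coeff g n‖) ≤ u n) : |inner ℝ f g| ≤ s := by
  have hb (n : ℤ) : |2 * Real.pi * inner ℝ (coeff f n) (coeff g n)| ≤ u n := by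
    rw [abs_mul, abs_of_pos Real.two_pi_pos]
    exact (mul_le_mul_of_nonneg_left (abs_real_inner_le_norm _ _) Real.two_pi_pos.le).trans (h n)
  refine abs_le.2 ⟨?_, ?_⟩
  · exact hasSum_le (fun n => (abs_le.1 (hb n)).1) hu.neg (hasSum_inner_coeff f g)
  · exact hasSum_le (fun n => (abs_le.1 (hb n)).2) (hasSum_inner_coeff f g) hu

/-! ### The heat operator -/

theorem heatSeries_sub {t : ℝ} (ht : 0 < t) (f g : L2) (x : ℝ) :
    heatSeries t (f - g) x = heatSeries t f x - heatSeries t g x := by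
  unfold heatSeries
  rw [← (summable_heatTerm ht f x).tsum_sub (summable_heatTerm ht g x)]
  refine tsum_congr fun n => ?_
  simp only [heatTerm, coeff_sub]
  ring

theorem heatOp_sub {t : ℝ} (ht : 0 < t) (f g : L2) :
    heatOp t ht (f - g) = heatOp t ht f - heatOp t ht g := by
  unfold heatOp
  rw [← MemLp.toLp_sub]
  refine MemLp.toLp_congr _ _ (ae_of_all _ fun x => ?_)
  simp [heatSeries_sub ht]

theorem norm_heatOp {t : ℝ} (ht : 0 < t) (f : L2) :
    ‖heatOp t ht f‖ = ∫ x, ‖heatSeries t f x‖ ∂circleMeasure := by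
  rw [L1.norm_eq_integral_norm]
  refine integral_congr_ae ?_
  filter_upwards [(memLp_heatSeries ht f).coeFn_toLp] with x hx
  unfold heatOp
  rw [hx, ← ofReal_re_heatSeries t f x, Complex.norm_real, Complex.ofReal_re]

theorem integral_exp_mul_exp (n m : ℤ) :
    ∫ x : ℝ, Complex.exp (-(Complex.I * n * x)) * Complex.exp (Complex.I * m * x) ∂circleMeasure
      = if m = n then (2 * Real.pi : ℂ) else 0 := by
  rw [← integral_circle_eq]
  split_ifs with h
  · subst h
    simp only [← Complex.exp_add, neg_add_cancel, Complex.exp_zero, intervalIntegral.integral_const,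
      sub_neg_eq_add, Complex.real_smul]
    push_cast
    ring
  · have hc : Complex.I * (m - n : ℂ) ≠ 0 :=
      mul_ne_zero Complex.I_ne_zero (sub_ne_zero.2 (by exact_mod_cast h))
    have hint : ∀ x : ℝ, Complex.exp (-(Complex.I * n * x)) * Complex.exp (Complex.I * m * x)
        = Complex.exp (Complex.I * (m - n : ℂ) * x) := fun x => by
      rw [← Complex.exp_add]
      ring_nf
    simp only [hint]
    rw [integral_exp_mul_complex hc, div_eq_zero_iff]
    left
    rw [sub_eq_zero, Complex.exp_eq_exp_iff_exists_int]
    refine ⟨m - n, ?_⟩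
    push_cast
    ring

/-- The series may be integrated termwise, since its terms are dominated by summable constants;
orthogonality leaves a single term. -/
theorem integral_exp_mul_heatSeries {t : ℝ} (ht : 0 < t) (f : L2) (n : ℤ) :
    ∫ x : ℝ, Complex.exp (-(Complex.I * n * x)) * heatSeries t f x ∂circleMeasure
      = 2 * Real.pi * (Real.exp (-(n : ℝ) ^ 2 * t) * coeff f n) := by
  have h1 : HasSum
      (fun m : ℤ => ∫ x : ℝ, Complex.exp (-(Complex.I * n * x)) * heatTerm t f m x ∂circleMeasure)
      (∫ x : ℝ, Complex.exp (-(Complex.I * n * x)) * heatSeries t f x ∂circleMeasure) := by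
    refine hasSum_integral_of_dominated_convergence
      (fun m _ => Real.exp (-(m : ℝ) ^ 2 * t) * ‖coeff f m‖) (fun m => ?_)
      (fun m => ae_of_all _ fun x => ?_) (ae_of_all _ fun x => summable_bound ht f)
      (integrable_const _) (ae_of_all _ fun x => ?_)
    · unfold heatTerm
      exact Continuous.aestronglyMeasurable (by fun_prop)
    · rw [norm_mul, norm_exp_neg_I_mul, one_mul, norm_heatTerm]
    · exact (summable_heatTerm ht f x).hasSum.mul_left _
  refine h1.unique ?_
  have h2 : ∀ m : ℤ,
      ∫ x : ℝ, Complex.exp (-(Complex.I * n * x)) * heatTerm t f m x ∂circleMeasure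
      = if m = n then 2 * Real.pi * (Real.exp (-(n : ℝ) ^ 2 * t) * coeff f n) else 0 := fun m => by
    have hint : ∀ x : ℝ, Complex.exp (-(Complex.I * n * x)) * heatTerm t f m x
        = (Real.exp (-(m : ℝ) ^ 2 * t) * coeff f m) *
          (Complex.exp (-(Complex.I * n * x)) * Complex.exp (Complex.I * m * x)) := fun x => by
      unfold heatTerm
      ring
    simp only [hint]
    rw [integral_const_mul, integral_exp_mul_exp]
    split_ifs with h
    · subst h
      ring
    · simp
  simp only [h2]
  exact hasSum_ite_eq n _

theorem exp_mul_norm_coeff_le {t : ℝ} (ht : 0 < t) (f : L2) (n : ℤ) :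
    2 * Real.pi * (Real.exp (-(n : ℝ) ^ 2 * t) * ‖coeff f n‖) ≤ ‖heatOp t ht f‖ := by
  have h := norm_integral_le_integral_norm (μ := circleMeasure)
    (fun x : ℝ => Complex.exp (-(Complex.I * n * x)) * heatSeries t f x)
  rw [integral_exp_mul_heatSeries ht] at h
  simp only [norm_mul, norm_exp_neg_I_mul, one_mul] at h
  rw [norm_heatOp ht]
  rwa [Complex.norm_real, Complex.norm_real, Real.norm_of_nonneg (Real.exp_pos _).le,
    Real.norm_of_nonneg Real.pi_pos.le, Complex.norm_ofNat] at h

/-! ### Interpolation inequality and impulsive noise -/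

/-- An interpolation inequality between `L^∞`, `L²` and `L¹`, obtained by truncating the
Fourier series at frequency `N`. -/
theorem norm_heatSeries_le {t : ℝ} (ht : 0 < t) (f : L2) (N : ℕ) (x : ℝ) :
    ‖heatSeries t f x‖ ≤ (2 * N + 1) / (2 * Real.pi) * ‖heatOp t ht f‖ +
      Real.exp (-(3 / 4 * (N + 1 : ℝ) ^ 2 * t)) *
        (∑' n : ℤ, Real.exp (-(n : ℝ) ^ 2 * (t / 4))) * ‖f‖ := by
  have ht4 : 0 < t / 4 := by positivity
  set a : ℝ := ‖heatOp t ht f‖ / (2 * Real.pi) with ha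
  have ha0 : 0 ≤ a := by positivity
  have hs : HasSum (fun n : ℤ => if n ∈ Finset.Icc (-N : ℤ) N then a else 0)
      (∑ n ∈ Finset.Icc (-N : ℤ) N, if n ∈ Finset.Icc (-N : ℤ) N then a else 0) :=
    hasSum_sum_of_ne_finset_zero fun n hn => if_neg hn
  have hg := ((summable_gauss ht4).hasSum.mul_left
    (Real.exp (-(3 / 4 * (N + 1 : ℝ) ^ 2 * t)))).mul_right ‖f‖
  have hcard : (∑ n ∈ Finset.Icc (-N : ℤ) N, if n ∈ Finset.Icc (-N : ℤ) N then a else 0)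
      = (2 * N + 1) / (2 * Real.pi) * ‖heatOp t ht f‖ := by
    rw [Finset.sum_ite_mem, Finset.inter_self, Finset.sum_const, Int.card_Icc, nsmul_eq_mul]
    have : ((N : ℤ) + 1 - -(N : ℤ)).toNat = 2 * N + 1 := by omega
    rw [this, ha]
    push_cast
    ring
  rw [hcard] at hs
  refine tsum_of_norm_bounded (hs.add hg) fun n => ?_
  rw [norm_heatTerm]
  split_ifs with hn
  · have h := exp_mul_norm_coeff_le ht f n
    have : Real.exp (-(n : ℝ) ^ 2 * t) * ‖coeff f n‖ ≤ a := by
      rw [ha, le_div_iff₀ (by positivity)]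
      linarith
    have h0 : 0 ≤ Real.exp (-(3 / 4 * (N + 1 : ℝ) ^ 2 * t)) *
      Real.exp (-(n : ℝ) ^ 2 * (t / 4)) * ‖f‖ := by positivity
    linarith
  -- Split `n²t = (3/4) n²t + n²t/4`: the first part is at least `(3/4)(N+1)²t`, the second keeps
  -- the sum over `n` finite.
  · rw [zero_add, ← Real.exp_add]
    refine mul_le_mul (Real.exp_le_exp.2 ?_) (norm_coeff_le_norm f n) (norm_nonneg _)
      (Real.exp_pos _).le
    have hN : (N + 1 : ℤ) ≤ |n| := by
      by_contra hlt
      exact hn (Finset.mem_Icc.2 (abs_le.1 (by omega)))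
    have hN' : (N + 1 : ℝ) ≤ |(n : ℝ)| := by exact_mod_cast hN
    have h2 : (N + 1 : ℝ) ^ 2 ≤ (n : ℝ) ^ 2 := by
      rw [← sq_abs (n : ℝ)]
      gcongr
    nlinarith

/-- The essential estimate for impulsive noise: the data misfit controls the error in `L¹` up to
the contribution of the corrupted set. -/
theorem IsImpulsive.exists_norm_le {ε η : ℝ} {ξ : L1} (h : IsImpulsive ε η ξ) (hη : 0 ≤ η) (u : L1)
    {v : ℝ → ℝ} (huv : u =ᵐ[circleMeasure] v) {B : ℝ} (hB : ∀ x, |v x| ≤ B) :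
    ‖u‖ ≤ ‖u - ξ‖ - ‖ξ‖ + 2 * ε + 2 * (η * B) := by
  obtain ⟨S, hS, hSI, hvol, hξ⟩ := h
  have iu : Integrable (fun x => u x) circleMeasure := L1.integrable_coeFn u
  have iξ : Integrable (fun x => ξ x) circleMeasure := L1.integrable_coeFn ξ
  have iuξ : Integrable (fun x => (u - ξ) x) circleMeasure := L1.integrable_coeFn (u - ξ)
  -- On `S` the triangle inequality is arranged so that only `u` is paid for, off `S` so that only
  -- `ξ` is. The size of `ξ` on `S` therefore never enters.
  have hpt : ∀ᵐ x ∂circleMeasure, |u x| ≤ |(u - ξ) x| - |ξ x| +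
      2 * Sᶜ.indicator (fun x => |ξ x|) x + 2 * S.indicator (fun x => |u x|) x := by
    filter_upwards [Lp.coeFn_sub u ξ] with x hx
    rw [hx, Pi.sub_apply]
    by_cases hxS : x ∈ S
    · rw [Set.indicator_of_notMem (by simpa using hxS), Set.indicator_of_mem hxS]
      have := abs_sub_abs_le_abs_sub (ξ x) (u x)
      rw [abs_sub_comm] at this
      linarith
    · rw [Set.indicator_of_mem (by simpa using hxS), Set.indicator_of_notMem hxS]
      have := abs_sub_abs_le_abs_sub (u x) (ξ x)
      linarith
  have i1 := (iξ.abs.indicator hS.compl).const_mul 2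
  have i2 := (iu.abs.indicator hS).const_mul 2
  have hle := integral_mono_ae iu.abs (((iuξ.abs.sub iξ.abs).add i1).add i2) hpt
  rw [integral_add' ((iuξ.abs.sub iξ.abs).add i1) i2, integral_add' (iuξ.abs.sub iξ.abs) i1,
    integral_sub' iuξ.abs iξ.abs, integral_const_mul, integral_const_mul,
    integral_indicator hS, integral_indicator hS.compl, Measure.restrict_restrict hS,
    Measure.restrict_restrict hS.compl, Set.inter_eq_self_of_subset_left hSI,
    Set.inter_comm, ← Set.sdiff_eq] at hle
  have hSfin : volume S < ⊤ := hvol.trans_lt ENNReal.ofReal_lt_top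
  have hB0 : 0 ≤ B := (abs_nonneg _).trans (hB 0)
  have hSB : ∫ x in S, |u x| ≤ η * B := by
    have h1 : ∫ x in S, |u x| = ∫ x in S, |v x| := by
      refine integral_congr_ae ?_
      filter_upwards [ae_restrict_of_ae_restrict_of_subset hSI huv] with x hx
      rw [hx]
    have h2 := norm_setIntegral_le_of_norm_le_const (f := fun x => |v x|) hSfin
      (fun x _ => by rw [Real.norm_eq_abs, abs_abs]; exact hB x)
    rw [h1]
    refine (le_abs_self _).trans (h2.trans ?_)
    rw [mul_comm]
    refine mul_le_mul_of_nonneg_right ?_ hB0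
    exact ENNReal.toReal_le_of_le_ofReal hη hvol
  simp only [L1.norm_eq_integral_norm, Real.norm_eq_abs]
  linarith

/-! ### Variational source condition -/

/-- Elements of the Sobolev space `H^p` satisfy a logarithmic variational source condition for
the heat operator. -/
theorem MemSobolev.exists_inner_le {t p : ℝ} (ht : 0 < t) (hp : 0 < p) {f : L2}
    (hf : MemSobolev p f) :
    ∃ C : ℝ, 0 ≤ C ∧ ∀ α : ℝ, 0 < α → α < 1 → ∀ h : L2,
      2 * |inner ℝ f h| ≤ 1 / (6 * α) * ‖heatOp t ht h‖ + 1 / 4 * ‖h‖ ^ 2 +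
        C * (-Real.log α) ^ (-p) := by
  set M : ℝ := ∑' n : ℤ, (1 + (n : ℝ) ^ 2) ^ p * ‖coeff f n‖ ^ 2 with hM
  have hM0 : 0 ≤ M := tsum_nonneg fun n => by positivity
  -- Threshold for `α^{-1/2}`: above `D`, the low frequencies fit into `X/(6α)`; below it, `α` is
  -- bounded away from `0`. The summand `2` makes `log D` positive.
  set D : ℝ := 12 * ((2 / t + 1) * ‖f‖) + 2 with hD
  have hD2 : 2 ≤ D := by
    have : 0 ≤ (2 / t + 1) * ‖f‖ := by positivity
    linarith
  have hlD : 0 < 2 * Real.log D := by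
    have := Real.log_pos (show (1 : ℝ) < D by linarith)
    linarith
  refine ⟨8 * Real.pi * M * (4 * t) ^ p + 4 * ‖f‖ ^ 2 * (2 * Real.log D) ^ p, by positivity,
    fun α hα0 hα1 h => ?_⟩
  have hl : 0 < -Real.log α := neg_pos.2 (Real.log_neg hα0 hα1)
  have hT := norm_nonneg (heatOp t ht h)
  by_cases hαD : -Real.log α ≤ 2 * Real.log D
  · -- the logarithmic term alone suffices away from `0`
    have h1 : (2 * Real.log D) ^ (-p) ≤ (-Real.log α) ^ (-p) :=
      Real.rpow_le_rpow_of_nonpos hl hαD (by linarith)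
    have h2 : 1 ≤ (2 * Real.log D) ^ p * (-Real.log α) ^ (-p) := by
      calc (1 : ℝ) = (2 * Real.log D) ^ p * (2 * Real.log D) ^ (-p) := by
            rw [← Real.rpow_add hlD, add_neg_cancel, Real.rpow_zero]
        _ ≤ _ := by gcongr
    have h3 := abs_real_inner_le_norm f h
    have h4 : 0 ≤ 8 * Real.pi * M * (4 * t) ^ p * (-Real.log α) ^ (-p) := by positivity
    have h5 : 0 ≤ 1 / (6 * α) * ‖heatOp t ht h‖ := by positivity
    nlinarith [sq_nonneg (‖f‖ * 2 - ‖h‖ / 2), sq_nonneg ‖f‖,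
      mul_le_mul_of_nonneg_left h2 (sq_nonneg ‖f‖)]
  · push Not at hαD
    -- This cut-off gives `e^{N²t} ≤ α^{-1/4}`. One such factor inverts the heat multiplier, another
    -- absorbs the number `2N+1` of low frequencies, so their product is at most `α^{-1/2}`.
    set N : ℕ := ⌊Real.sqrt (-Real.log α / (4 * t))⌋₊ with hN
    have hlt : 0 < -Real.log α / (4 * t) := by positivity
    have hN1 : (N : ℝ) ^ 2 * (4 * t) ≤ -Real.log α := by
      have h1 : (N : ℝ) ≤ Real.sqrt (-Real.log α / (4 * t)) := Nat.floor_le (Real.sqrt_nonneg _)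
      have h2 : (N : ℝ) ^ 2 ≤ -Real.log α / (4 * t) := by
        rw [← Real.sq_sqrt hlt.le]
        gcongr
      rwa [le_div_iff₀ (by positivity)] at h2
    have hN2 : -Real.log α / (4 * t) ≤ 1 + (N + 1 : ℝ) ^ 2 := by
      have h1 : Real.sqrt (-Real.log α / (4 * t)) ≤ N + 1 := (Nat.lt_floor_add_one _).le
      have h2 : -Real.log α / (4 * t) ≤ (N + 1 : ℝ) ^ 2 := by
        rw [← Real.sq_sqrt hlt.le]
        gcongr
      linarith
    set a : ℝ := ‖f‖ * (Real.exp ((N : ℝ) ^ 2 * t) * ‖heatOp t ht h‖) with ha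
    set κ : ℝ := (-Real.log α / (4 * t)) ^ (-p) with hκ
    have hκ0 : 0 < κ := by positivity
    have ha0 : 0 ≤ a := by positivity
    have hs : HasSum (fun n : ℤ => if n ∈ Finset.Icc (-N : ℤ) N then a else 0)
        (∑ n ∈ Finset.Icc (-N : ℤ) N, if n ∈ Finset.Icc (-N : ℤ) N then a else 0) :=
      hasSum_sum_of_ne_finset_zero fun n hn => if_neg hn
    have hcard : (∑ n ∈ Finset.Icc (-N : ℤ) N, if n ∈ Finset.Icc (-N : ℤ) N then a else 0)
        = (2 * N + 1) * a := by
      rw [Finset.sum_ite_mem, Finset.inter_self, Finset.sum_const, Int.card_Icc, nsmul_eq_mul]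
      have : ((N : ℤ) + 1 - -(N : ℤ)).toNat = 2 * N + 1 := by omega
      rw [this]
      push_cast
      ring
    rw [hcard] at hs
    have hsum := (hs.add (hf.hasSum.mul_left (4 * Real.pi * κ))).add
      ((hasSum_norm_coeff_sq h).mul_left (1 / 8))
    have key := abs_inner_le_of_hasSum (f := f) (g := h) hsum fun n => by
      split_ifs with hn
      · have h1 := exp_mul_norm_coeff_le ht h n
        have hnN : (n : ℝ) ^ 2 ≤ (N : ℝ) ^ 2 := by
          have : |(n : ℝ)| ≤ N := by exact_mod_cast abs_le.2 (Finset.mem_Icc.1 hn)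
          rw [← sq_abs (n : ℝ)]
          gcongr
        have h2 : 2 * Real.pi * ‖coeff h n‖ ≤ Real.exp ((N : ℝ) ^ 2 * t) * ‖heatOp t ht h‖ := by
          calc 2 * Real.pi * ‖coeff h n‖
              = Real.exp ((n : ℝ) ^ 2 * t) *
                (2 * Real.pi * (Real.exp (-(n : ℝ) ^ 2 * t) * ‖coeff h n‖)) := by
                have : Real.exp ((n : ℝ) ^ 2 * t) * Real.exp (-(n : ℝ) ^ 2 * t) = 1 := by
                  rw [← Real.exp_add, ← Real.exp_zero]
                  ring_nf
                linear_combination (-(2 * Real.pi * ‖coeff h n‖)) * this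
            _ ≤ _ := by gcongr
        have h3 : 2 * Real.pi * (‖coeff f n‖ * ‖coeff h n‖) ≤ a := by
          calc _ = ‖coeff f n‖ * (2 * Real.pi * ‖coeff h n‖) := by ring
            _ ≤ a := mul_le_mul (norm_coeff_le_norm f n) h2 (by positivity) (norm_nonneg _)
        have h4 : 0 ≤ 4 * Real.pi * κ * ((1 + (n : ℝ) ^ 2) ^ p * ‖coeff f n‖ ^ 2) := by positivity
        have h5 : 0 ≤ 1 / 8 * (2 * Real.pi * ‖coeff h n‖ ^ 2) := by positivity
        linarith
      · have hNn : (N + 1 : ℤ) ≤ |n| := by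
          by_contra hlt
          exact hn (Finset.mem_Icc.2 (abs_le.1 (by omega)))
        have hNn' : (N + 1 : ℝ) ≤ |(n : ℝ)| := by exact_mod_cast hNn
        have h2 : (N + 1 : ℝ) ^ 2 ≤ (n : ℝ) ^ 2 := by
          rw [← sq_abs (n : ℝ)]
          gcongr
        have h3 : 1 ≤ κ * (1 + (n : ℝ) ^ 2) ^ p := by
          have : -Real.log α / (4 * t) ≤ 1 + (n : ℝ) ^ 2 := by linarith
          calc (1 : ℝ) = κ * (-Real.log α / (4 * t)) ^ p := by
                rw [hκ, ← Real.rpow_add hlt, neg_add_cancel, Real.rpow_zero]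
            _ ≤ _ := by gcongr
        have h4 := mul_le_mul_of_nonneg_right h3
          (show 0 ≤ Real.pi * ‖coeff f n‖ ^ 2 by positivity)
        -- Young's inequality; its weights leave `2π|ĥ(n)|²/8`, which after doubling and summation
        -- gives `‖h‖²/4`.
        have h5 := mul_nonneg Real.pi_pos.le (sq_nonneg (2 * ‖coeff f n‖ - ‖coeff h n‖ / 2))
        nlinarith
    have hκ' : κ = (4 * t) ^ p * (-Real.log α) ^ (-p) := by
      rw [hκ, Real.div_rpow hl.le (by positivity), Real.rpow_neg (by positivity : 0 ≤ 4 * t),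
        div_inv_eq_mul, mul_comm]
    have hlow : 2 * ((2 * N + 1) * a) ≤ 1 / (6 * α) * ‖heatOp t ht h‖ := by
      have h1 : (2 * N + 1 : ℝ) ≤ (2 / t + 1) * Real.exp ((N : ℝ) ^ 2 * t) := by
        have hx := Real.add_one_le_exp ((N : ℝ) ^ 2 * t)
        have hNN : (N : ℝ) ≤ (N : ℝ) ^ 2 := by exact_mod_cast Nat.le_self_pow two_ne_zero N
        have h0 : (0 : ℝ) ≤ (N : ℝ) ^ 2 * t := by positivity
        calc (2 * N + 1 : ℝ) ≤ 2 / t * ((N : ℝ) ^ 2 * t) + 1 := by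
              have : 2 / t * ((N : ℝ) ^ 2 * t) = 2 * (N : ℝ) ^ 2 := by field_simp
              linarith
          _ ≤ 2 / t * Real.exp ((N : ℝ) ^ 2 * t) + Real.exp ((N : ℝ) ^ 2 * t) := by
              gcongr
              · linarith
              · linarith
          _ = _ := by ring
      have h2 : Real.exp ((N : ℝ) ^ 2 * t) * Real.exp ((N : ℝ) ^ 2 * t)
          ≤ Real.exp (-Real.log α / 2) := by
        rw [← Real.exp_add]
        exact Real.exp_le_exp.2 (by linarith)
      have h3 : D ≤ Real.exp (-Real.log α / 2) := by
        rw [← Real.log_le_iff_le_exp (by linarith)]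
        linarith
      have h4 : Real.exp (-Real.log α / 2) * Real.exp (-Real.log α / 2) = 1 / α := by
        rw [← Real.exp_add, add_halves, Real.exp_neg, Real.exp_log hα0, one_div]
      have h5 : 12 * ((2 / t + 1) * ‖f‖) ≤ D := by linarith
      have h6 : 12 * ((2 / t + 1) * ‖f‖) *
          (Real.exp ((N : ℝ) ^ 2 * t) * Real.exp ((N : ℝ) ^ 2 * t)) ≤ 1 / α := by
        rw [← h4]
        exact mul_le_mul (h5.trans h3) h2 (by positivity) (Real.exp_pos _).le
      calc 2 * ((2 * N + 1) * a) ≤ 2 * ((2 / t + 1) * Real.exp ((N : ℝ) ^ 2 * t) * a) := by gcongr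
        _ = 1 / 6 * (12 * ((2 / t + 1) * ‖f‖) *
          (Real.exp ((N : ℝ) ^ 2 * t) * Real.exp ((N : ℝ) ^ 2 * t))) * ‖heatOp t ht h‖ := by
            rw [ha]
            ring
        _ ≤ 1 / 6 * (1 / α) * ‖heatOp t ht h‖ := by gcongr
        _ = _ := by
            field_simp
    have h9 : 0 ≤ 4 * ‖f‖ ^ 2 * (2 * Real.log D) ^ p * (-Real.log α) ^ (-p) := by positivity
    rw [hκ'] at key
    linarith

/-! ### The general error bound -/

theorem exp_neg_le_rpow {p w : ℝ} (hp : 0 < p) (hw : 0 < w) : Real.exp (-w) ≤ (w / p) ^ (-p) := by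
  have h1 : w / p ≤ Real.exp (w / p) := by linarith [Real.add_one_le_exp (w / p)]
  have h2 : (w / p) ^ p ≤ Real.exp w := by
    calc (w / p) ^ p ≤ Real.exp (w / p) ^ p := by gcongr
      _ = Real.exp w := by rw [← Real.exp_mul, div_mul_cancel₀ _ hp.ne']
  rw [Real.exp_neg, Real.rpow_neg (by positivity)]
  exact inv_anti₀ (by positivity) h2

theorem div_sq_rpow_neg {c η : ℝ} (hc : 0 < c) (hη : 0 < η) (p : ℝ) :
    (c / η ^ 2) ^ (-p) = c ^ (-p) * η ^ (2 * p) := by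
  rw [Real.div_rpow hc.le (by positivity), Real.rpow_neg (by positivity : 0 ≤ η ^ 2), div_inv_eq_mul,
    Real.rpow_mul hη.le, Real.rpow_two]

/-- With `z = π/η` the exponent on the left is `-(3/2)(z/3 - 1/2)² t`, of leading order `-z²t/6`.
The surplus `z²t/24` over `z²t/8` is halved: one `z²t/48` absorbs the linear term by completing the
square `(z - 12)²`, the other yields `η^{2p}` through `exp_neg_le_rpow`. -/
theorem exists_exp_sq_le {t p : ℝ} (ht : 0 < t) (hp : 0 < p) :
    ∃ K : ℝ, 0 < K ∧ ∀ η : ℝ, 0 < η →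
      Real.exp (-(3 / 4 * (Real.pi / (3 * η) - 1 / 2) ^ 2 * t)) ^ 2 ≤
        K * (η ^ (2 * p) * Real.exp (-(Real.pi ^ 2 / (8 * η ^ 2)) * t)) := by
  have hc : 0 < Real.pi ^ 2 * t / 48 / p := by positivity
  refine ⟨Real.exp (21 / 8 * t) * (Real.pi ^ 2 * t / 48 / p) ^ (-p), by positivity, fun η hη => ?_⟩
  have h1 := exp_neg_le_rpow hp (show 0 < Real.pi ^ 2 * t / 48 / η ^ 2 by positivity)
  rw [show Real.pi ^ 2 * t / 48 / η ^ 2 / p = Real.pi ^ 2 * t / 48 / p / η ^ 2 by ring,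
    div_sq_rpow_neg hc hη] at h1
  set z : ℝ := Real.pi / η with hz
  calc Real.exp (-(3 / 4 * (Real.pi / (3 * η) - 1 / 2) ^ 2 * t)) ^ 2
      = Real.exp (-(3 / 2 * (z / 3 - 1 / 2) ^ 2 * t)) := by
        rw [← Real.exp_nat_mul, hz]
        congr 1
        push_cast
        field_simp
        ring
    _ ≤ Real.exp (21 / 8 * t + -(z ^ 2 * t / 48) + -(z ^ 2 / 8) * t) := by
        refine Real.exp_le_exp.2 ?_
        have : 0 ≤ (z - 12) ^ 2 * t := by positivity
        nlinarith
    _ = Real.exp (21 / 8 * t) * Real.exp (-(Real.pi ^ 2 * t / 48 / η ^ 2)) *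
          Real.exp (-(Real.pi ^ 2 / (8 * η ^ 2)) * t) := by
        rw [← Real.exp_add, ← Real.exp_add, hz]
        congr 1
        field_simp
    _ ≤ Real.exp (21 / 8 * t) * ((Real.pi ^ 2 * t / 48 / p) ^ (-p) * η ^ (2 * p)) *
          Real.exp (-(Real.pi ^ 2 / (8 * η ^ 2)) * t) := by gcongr
    _ = _ := by ring

/-- The contribution of the corrupted set to the error of a Tikhonov minimizer. -/
theorem IsImpulsive.norm_heatOp_le {t ε η : ℝ} (ht : 0 < t) {ξ : L1} (hξ : IsImpulsive ε η ξ)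
    (hη : 0 < η) (hη' : η ≤ 1 / 2) (h : L2) :
    1 / 3 * ‖heatOp t ht h‖ ≤ ‖heatOp t ht h - ξ‖ - ‖ξ‖ + 2 * ε +
      2 * η * (Real.exp (-(3 / 4 * (Real.pi / (3 * η) - 1 / 2) ^ 2 * t)) *
        (∑' n : ℤ, Real.exp (-(n : ℝ) ^ 2 * (t / 4))) * ‖h‖) := by
  -- Chosen so that `(2r + 1)/(2π) = 1/(3η)`. The contribution of `S` is then at most `(2/3)‖T h‖`
  -- plus the tail, and the first part is absorbed on the left.
  set r : ℝ := Real.pi / (3 * η) - 1 / 2 with hr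
  have hr0 : 0 ≤ r := by
    rw [hr, sub_nonneg, le_div_iff₀ (by positivity)]
    linarith [Real.pi_gt_three]
  have hN1 : (⌊r⌋₊ : ℝ) ≤ r := Nat.floor_le hr0
  have hN2 : r ≤ ⌊r⌋₊ + 1 := (Nat.lt_floor_add_one r).le
  have hS : 0 ≤ ∑' n : ℤ, Real.exp (-(n : ℝ) ^ 2 * (t / 4)) := tsum_nonneg fun n => by positivity
  have key := hξ.exists_norm_le hη.le (heatOp t ht h)
    (memLp_heatSeries ht h).coeFn_toLp
    fun x => (Complex.abs_re_le_norm _).trans (norm_heatSeries_le ht h ⌊r⌋₊ x)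
  have h1 : (2 * ⌊r⌋₊ + 1) / (2 * Real.pi) ≤ 1 / (3 * η) := by
    calc (2 * ⌊r⌋₊ + 1) / (2 * Real.pi) ≤ (2 * r + 1) / (2 * Real.pi) := by gcongr
      _ = 1 / (3 * η) := by
        rw [hr]
        field_simp
        ring
  have h2 : (2 * ⌊r⌋₊ + 1) / (2 * Real.pi) * ‖heatOp t ht h‖ +
      Real.exp (-(3 / 4 * (⌊r⌋₊ + 1 : ℝ) ^ 2 * t)) *
        (∑' n : ℤ, Real.exp (-(n : ℝ) ^ 2 * (t / 4))) * ‖h‖ ≤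
      1 / (3 * η) * ‖heatOp t ht h‖ + Real.exp (-(3 / 4 * r ^ 2 * t)) *
        (∑' n : ℤ, Real.exp (-(n : ℝ) ^ 2 * (t / 4))) * ‖h‖ := by
    gcongr
  have h3 := mul_le_mul_of_nonneg_left h2 hη.le
  have h4 : η * (1 / (3 * η) * ‖heatOp t ht h‖) = 1 / 3 * ‖heatOp t ht h‖ := by field_simp
  rw [mul_add η (1 / (3 * η) * _), h4] at h3
  linarith

/-- Error bound for minimizers of the Tikhonov functional with impulsive noise. -/
theorem MemSobolev.exists_error_bound {t p : ℝ} (ht : 0 < t) (hp : 0 < p) {f : L2}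
    (hf : MemSobolev p f) :
    ∃ C : ℝ, 0 < C ∧ ∀ η ε α : ℝ, 0 < η → η ≤ 1 / 2 → 0 ≤ ε → 0 < α → α < 1 →
      ∀ ξ : L1, IsImpulsive ε η ξ →
      ∀ fα : L2, IsTikhonovMin t ht α (heatOp t ht f + ξ) fα →
        ‖fα - f‖ ^ 2 ≤ C * (ε / α + η ^ 2 / α ^ 2 *
          (η ^ (2 * p) * Real.exp (-(Real.pi ^ 2 / (8 * η ^ 2)) * t)) + (-Real.log α) ^ (-p)) ∧
        ‖heatOp t ht fα - heatOp t ht f‖ ≤ C * (α * (ε / α + η ^ 2 / α ^ 2 *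
          (η ^ (2 * p) * Real.exp (-(Real.pi ^ 2 / (8 * η ^ 2)) * t)) + (-Real.log α) ^ (-p))) := by
  obtain ⟨C₀, hC₀, hsrc⟩ := hf.exists_inner_le ht hp
  obtain ⟨K, hK, hexp⟩ := exists_exp_sq_le ht hp
  set S : ℝ := ∑' n : ℤ, Real.exp (-(n : ℝ) ^ 2 * (t / 4)) with hS
  refine ⟨6 * (2 + 4 * S ^ 2 * K + C₀), by positivity, fun η ε α hη hη' hε hα hα1 ξ hξ fα hmin => ?_⟩
  have himp := hξ.norm_heatOp_le ht hη hη' (fα - f)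
  have hsource := hsrc α hα hα1 (fα - f)
  have hE := hexp η hη
  rw [← hS] at himp
  set G : ℝ := Real.exp (-(3 / 4 * (Real.pi / (3 * η) - 1 / 2) ^ 2 * t)) with hG
  set E : ℝ := η ^ (2 * p) * Real.exp (-(Real.pi ^ 2 / (8 * η ^ 2)) * t) with hEdef
  set L : ℝ := (-Real.log α) ^ (-p) with hL
  have hL0 : 0 ≤ L := Real.rpow_nonneg (neg_nonneg.2 (Real.log_nonpos hα.le hα1.le)) _
  have hmin' := hmin f
  have e1 : heatOp t ht fα - (heatOp t ht f + ξ) = heatOp t ht (fα - f) - ξ := by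
    rw [heatOp_sub]
    abel
  have e2 : heatOp t ht f - (heatOp t ht f + ξ) = -ξ := by abel
  have e3 : ‖fα‖ ^ 2 = ‖fα - f‖ ^ 2 + 2 * inner ℝ f (fα - f) + ‖f‖ ^ 2 := by
    rw [← real_inner_comm, ← norm_add_sq_real, sub_add_cancel]
  rw [tikhonov, tikhonov, e1, e2, norm_neg, e3] at hmin'
  rw [← heatOp_sub]
  set X : ℝ := ‖heatOp t ht (fα - f)‖ with hX
  set y : ℝ := ‖fα - f‖ with hy
  have hX0 : 0 ≤ X := norm_nonneg _
  have hα' : 0 < 1 / α := by positivity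
  have habs := neg_abs_le (inner ℝ f (fα - f))
  have himp' := mul_le_mul_of_nonneg_left himp hα'.le
  have hYoung : 2 * (η / α * G * S * y) ≤ 1 / 4 * y ^ 2 + 4 * (η / α * G * S) ^ 2 := by
    linarith [sq_nonneg (y / 2 - 2 * (η / α * G * S))]
  have hGE : (η / α * G * S) ^ 2 ≤ η ^ 2 / α ^ 2 * E * (S ^ 2 * K) := by
    calc (η / α * G * S) ^ 2 = η ^ 2 / α ^ 2 * S ^ 2 * G ^ 2 := by ring
      _ ≤ η ^ 2 / α ^ 2 * S ^ 2 * (K * E) := by gcongr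
      _ = _ := by ring
  -- Of `X/(3α) + y²` on the left, the source condition consumes `X/(6α)` and `y²/4`, and Young's
  -- inequality for the tail another `y²/4`.
  have hmain : 1 / (6 * α) * X + 1 / 2 * y ^ 2 ≤
      2 * (ε / α) + 4 * S ^ 2 * K * (η ^ 2 / α ^ 2 * E) + C₀ * L := by
    have h1 : 1 / α * (1 / 3 * X) = 2 * (1 / (6 * α) * X) := by
      field_simp
      ring
    have h2 : 1 / α * (‖heatOp t ht (fα - f) - ξ‖ - ‖ξ‖ + 2 * ε + 2 * η * (G * S * y)) =
        1 / α * ‖heatOp t ht (fα - f) - ξ‖ - 1 / α * ‖ξ‖ + 2 * (ε / α) +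
          2 * (η / α * G * S * y) := by
      ring
    rw [h1, h2] at himp'
    linarith only [himp', hmin', hsource, habs, hYoung, hGE]
  have hA : 0 ≤ ε / α := by positivity
  have hB : 0 ≤ η ^ 2 / α ^ 2 * E := by positivity
  have hsum : 2 * (ε / α) + 4 * S ^ 2 * K * (η ^ 2 / α ^ 2 * E) + C₀ * L ≤
      (2 + 4 * S ^ 2 * K + C₀) * (ε / α + η ^ 2 / α ^ 2 * E + L) := by
    have hc : 0 ≤ 4 * S ^ 2 * K := by positivity
    linarith only [mul_nonneg hc hA, mul_nonneg hC₀ hA, mul_nonneg hC₀ hB, mul_nonneg hc hL0,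
      hA, hB, hL0]
  set R : ℝ := (2 + 4 * S ^ 2 * K + C₀) * (ε / α + η ^ 2 / α ^ 2 * E + L) with hR
  have hXα : 0 ≤ 1 / (6 * α) * X := by positivity
  constructor
  · linarith only [hmain, hsum, hR, hXα, sq_nonneg y]
  · have h1 : 1 / (6 * α) * X ≤ R := by linarith only [hmain, hsum, sq_nonneg y]
    have h2 := mul_le_mul_of_nonneg_left h1 (show 0 ≤ 6 * α by positivity)
    have h3 : 6 * α * (1 / (6 * α) * X) = X := by field_simp
    rw [h3] at h2
    rw [hR] at h2
    linarith only [h2]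

/-! ### A priori parameter choice -/

/-- The parameter choice `max (ε (-log ε)^p, η exp (-π² t / (16 η²)))`. -/
noncomputable def paramChoice (t p ε η : ℝ) : ℝ :=
  max (ε * (-Real.log ε) ^ p) (η * Real.exp (-(Real.pi ^ 2 / (16 * η ^ 2)) * t))

theorem paramChoice_pos (t p ε : ℝ) {η : ℝ} (hη : 0 < η) : 0 < paramChoice t p ε η :=
  lt_max_of_lt_right (by positivity)

/-- Near `0` the factor `(-log ε)^p` costs at most `ε^{-1/2}`. Positivity is a premise inside the
filter because `𝓝[≥] 0` contains `ε = 0`. -/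
theorem eventually_log_neg_log_le {p : ℝ} (hp : 0 < p) :
    ∀ᶠ ε : ℝ in 𝓝[≥] 0, 0 < ε → 1 ≤ -Real.log ε ∧
      p * Real.log (-Real.log ε) ≤ 1 / 2 * -Real.log ε := by
  have hl : Tendsto (fun ε : ℝ => -Real.log ε) (𝓝[>] 0) atTop :=
    tendsto_neg_atBot_atTop.comp Real.tendsto_log_nhdsGT_zero
  have h1 : ∀ᶠ x : ℝ in atTop, 1 ≤ x ∧ p * Real.log x ≤ 1 / 2 * x := by
    have h := Real.isLittleO_log_id_atTop.bound (show 0 < 1 / (2 * p) by positivity)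
    filter_upwards [h, eventually_ge_atTop 1] with x hx hx1
    refine ⟨hx1, ?_⟩
    rw [Real.norm_of_nonneg (Real.log_nonneg hx1), id, Real.norm_of_nonneg (by linarith)] at hx
    calc p * Real.log x ≤ p * (1 / (2 * p) * x) := by gcongr
      _ = 1 / 2 * x := by field_simp
  exact (eventually_nhdsWithin_iff.1 (hl.eventually h1)).filter_mono nhdsWithin_le_nhds

theorem mul_rpow_neg_log_le_sqrt {p ε : ℝ} (hε : 0 < ε) (h1 : 1 ≤ -Real.log ε)
    (h2 : p * Real.log (-Real.log ε) ≤ 1 / 2 * -Real.log ε) :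
    ε * (-Real.log ε) ^ p ≤ Real.sqrt ε := by
  rw [Real.sqrt_eq_rpow, Real.rpow_def_of_pos hε, Real.rpow_def_of_pos (by linarith)]
  nth_rewrite 1 [← Real.exp_log hε]
  rw [← Real.exp_add]
  exact Real.exp_le_exp.2 (by linarith)

theorem tendsto_paramChoice {t p : ℝ} (ht : 0 < t) (hp : 0 < p) :
    Tendsto (fun q : ℝ × ℝ => paramChoice t p q.1 q.2) (𝓝[≥] 0 ×ˢ 𝓝[>] 0) (𝓝[>] 0) := by
  refine tendsto_nhdsWithin_iff.2 ⟨?_, ?_⟩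
  · have ha : Tendsto (fun ε : ℝ => ε * (-Real.log ε) ^ p) (𝓝[≥] 0) (𝓝 0) := by
      have hs : Tendsto Real.sqrt (𝓝[≥] 0) (𝓝 0) := by
        exact (Real.continuous_sqrt.tendsto' 0 0 Real.sqrt_zero).mono_left nhdsWithin_le_nhds
      refine tendsto_of_tendsto_of_tendsto_of_le_of_le' tendsto_const_nhds hs ?_ ?_
      · filter_upwards [eventually_log_neg_log_le hp, self_mem_nhdsWithin] with ε h hε
        rcases (Set.mem_Ici.1 hε).eq_or_lt with rfl | h0
        · simp
        · have := (h h0).1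
          positivity
      · filter_upwards [eventually_log_neg_log_le hp, self_mem_nhdsWithin] with ε h hε
        rcases (Set.mem_Ici.1 hε).eq_or_lt with rfl | h0
        · simp
        · exact mul_rpow_neg_log_le_sqrt h0 (h h0).1 (h h0).2
    have hb : Tendsto (fun η : ℝ => η * Real.exp (-(Real.pi ^ 2 / (16 * η ^ 2)) * t))
        (𝓝[>] 0) (𝓝 0) := by
      refine tendsto_of_tendsto_of_tendsto_of_le_of_le' tendsto_const_nhds
        (tendsto_nhdsWithin_of_tendsto_nhds tendsto_id) ?_ ?_
      · filter_upwards [self_mem_nhdsWithin] with η hη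
        have : 0 < η := hη
        positivity
      · filter_upwards [self_mem_nhdsWithin] with η hη
        have h0 : 0 < η := hη
        refine mul_le_of_le_one_right h0.le (Real.exp_le_one_iff.2 ?_)
        rw [neg_mul, neg_nonpos]
        positivity
    have hmax := (ha.comp (tendsto_fst (g := 𝓝[>] (0 : ℝ)))).max
      (hb.comp (tendsto_snd (f := 𝓝[≥] (0 : ℝ))))
    rwa [max_self] at hmax
  · filter_upwards [tendsto_snd.eventually self_mem_nhdsWithin] with q hq
    exact paramChoice_pos t p q.1 hq

/-- The first entry of the maximum gives the bound for `ε > 0`. At `ε = 0` both sides vanish, since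
`Real.log 0 = 0` and `0 ^ (-p) = 0`. -/
theorem div_paramChoice_le (t : ℝ) {p ε η : ℝ} (hp : 0 < p) (hε : 0 ≤ ε)
    (h : 0 < ε → 1 ≤ -Real.log ε) : ε / paramChoice t p ε η ≤ (-Real.log ε) ^ (-p) := by
  rcases hε.eq_or_lt with rfl | h0
  · simp [Real.zero_rpow (neg_ne_zero.2 hp.ne')]
  · have hl : 0 < -Real.log ε := by linarith [h h0]
    calc ε / paramChoice t p ε η ≤ ε / (ε * (-Real.log ε) ^ p) := by
          gcongr
          exact le_max_left _ _
      _ = (-Real.log ε) ^ (-p) := by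
          rw [Real.rpow_neg hl.le]
          field_simp

theorem gammaHeat_two_mul_le {t η : ℝ} (ht : 0 < t) (hη : 0 < η) (hη1 : η ≤ 1) :
    gammaHeat t (2 * η) ≤ 8 * max 1 (t ^ (-(1 / 2) : ℝ)) / (Real.exp (3 * t) - 1) *
      (Real.exp (3 / 4 * t) * Real.exp (-(Real.pi ^ 2 / (16 * η ^ 2)) * t)) := by
  unfold gammaHeat
  have h1 : 0 < Real.exp (3 * t) - 1 := sub_pos.2 (Real.one_lt_exp_iff.2 (by positivity))
  refine mul_le_mul_of_nonneg_left ?_ (by positivity)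
  rw [← Real.exp_add]
  refine Real.exp_le_exp.2 ?_
  set z : ℝ := Real.pi / η with hz
  have e1 : Real.pi / (2 * η) - 1 / 2 = z / 2 - 1 / 2 := by
    rw [hz]
    field_simp
  have e2 : Real.pi ^ 2 / (16 * η ^ 2) = z ^ 2 / 16 := by
    rw [hz]
    field_simp
  have hz3 : 3 ≤ z := by
    rw [hz, le_div_iff₀ hη]
    nlinarith [Real.pi_gt_three]
  rw [e1, e2]
  have hfl : z / 2 - 3 / 2 ≤ (⌊z / 2 - 1 / 2⌋ : ℤ) := by
    linarith [Int.lt_floor_add_one (z / 2 - 1 / 2)]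
  have hsq : (z / 2 - 3 / 2) ^ 2 ≤ ((⌊z / 2 - 1 / 2⌋ : ℤ) : ℝ) ^ 2 := by
    have : 0 ≤ z / 2 - 3 / 2 := by linarith
    gcongr
  -- Completing the square: `(z/2 - 3/2)² - z²/16 + 3/4 = (3/16)(z - 4)²`, whence the factor
  -- `exp(3t/4)`.
  have h3 : 0 ≤ (z - 4) ^ 2 * t := by positivity
  nlinarith

theorem exists_paramCond_paramChoice {t p : ℝ} (ht : 0 < t) (hp : 0 < p) :
    ∃ Ce : ℝ, 0 < Ce ∧ ∀ᶠ q : ℝ × ℝ in 𝓝[≥] 0 ×ˢ 𝓝[>] 0,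
      ParamCond t Ce q.1 q.2 (paramChoice t p q.1 q.2) := by
  set A : ℝ := 8 * max 1 (t ^ (-(1 / 2) : ℝ)) / (Real.exp (3 * t) - 1) with hA
  have hA0 : 0 < A := by
    have h1 : 0 < Real.exp (3 * t) - 1 := sub_pos.2 (Real.one_lt_exp_iff.2 (by positivity))
    positivity
  refine ⟨Real.sqrt 2 + 2 * (A * Real.exp (3 / 4 * t)), by positivity, ?_⟩
  filter_upwards [tendsto_fst.eventually (eventually_log_neg_log_le hp),
    tendsto_fst.eventually self_mem_nhdsWithin, tendsto_snd.eventually self_mem_nhdsWithin,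
    tendsto_snd.eventually (Ioc_mem_nhdsGT one_pos)] with q hlog hε hη hη1
  obtain ⟨ε, η⟩ := q
  replace hε : 0 ≤ ε := hε
  replace hη : 0 < η := hη
  dsimp only at *
  have hα := paramChoice_pos t p ε hη
  refine add_le_add (Real.sqrt_le_sqrt ?_) ?_
  · have h1 := div_paramChoice_le t (η := η) hp hε fun h => (hlog h).1
    have h2 : (-Real.log ε) ^ (-p) ≤ 1 := by
      rcases hε.eq_or_lt with rfl | h0
      · simp [Real.zero_rpow (neg_ne_zero.2 hp.ne')]
      · exact Real.rpow_le_one_of_one_le_of_nonpos (hlog h0).1 (by linarith)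
    rw [mul_div_assoc]
    linarith
  · rw [div_le_iff₀ hα]
    have h1 := gammaHeat_two_mul_le ht hη hη1.2
    calc 2 * η * gammaHeat t (2 * η)
        ≤ 2 * η * (A * (Real.exp (3 / 4 * t) *
          Real.exp (-(Real.pi ^ 2 / (16 * η ^ 2)) * t))) := by gcongr
      _ = 2 * (A * Real.exp (3 / 4 * t)) *
          (η * Real.exp (-(Real.pi ^ 2 / (16 * η ^ 2)) * t)) := by ring
      _ ≤ _ := by
          gcongr
          exact le_max_right _ _

theorem neg_log_rpow_le_of_mul_rpow {p ε : ℝ} (hp : 0 < p) (hε : 0 < ε) (h1 : 1 ≤ -Real.log ε)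
    (h2 : p * Real.log (-Real.log ε) ≤ 1 / 2 * -Real.log ε) :
    (-Real.log (ε * (-Real.log ε) ^ p)) ^ (-p) ≤ 2 ^ p * (-Real.log ε) ^ (-p) := by
  have hl : 0 < -Real.log ε := by linarith
  have h3 : -Real.log ε / 2 ≤ -Real.log (ε * (-Real.log ε) ^ p) := by
    rw [Real.log_mul hε.ne' (by positivity), Real.log_rpow hl]
    linarith
  calc _ ≤ (-Real.log ε / 2) ^ (-p) := Real.rpow_le_rpow_of_nonpos (by positivity) h3 (by linarith)
    _ = _ := by
      rw [Real.div_rpow hl.le zero_le_two, Real.rpow_neg zero_le_two, div_inv_eq_mul, mul_comm]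

theorem neg_log_rpow_le_of_mul_exp {t p η : ℝ} (ht : 0 < t) (hp : 0 < p) (hη : 0 < η)
    (hη1 : η ≤ 1) :
    (-Real.log (η * Real.exp (-(Real.pi ^ 2 / (16 * η ^ 2)) * t))) ^ (-p) ≤
      (Real.pi ^ 2 * t / 16) ^ (-p) * η ^ (2 * p) := by
  rw [← div_sq_rpow_neg (by positivity) hη]
  refine Real.rpow_le_rpow_of_nonpos (by positivity) ?_ (by linarith)
  rw [Real.log_mul hη.ne' (Real.exp_pos _).ne', Real.log_exp]
  have h1 := Real.log_nonpos hη.le hη1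
  have h2 : Real.pi ^ 2 * t / 16 / η ^ 2 = Real.pi ^ 2 / (16 * η ^ 2) * t := by field_simp
  linarith

/-- Whichever entry attains the maximum, `-log α` is at least `-log ε / 2` or `π²t/(16η²)`. In the
first case the powers of `-log ε` cancel in `α (-log α)^{-p}`, leaving a multiple of `ε`. -/
theorem exists_neg_log_paramChoice_le {t p : ℝ} (ht : 0 < t) (hp : 0 < p) :
    ∃ K : ℝ, 0 < K ∧ ∀ᶠ q : ℝ × ℝ in 𝓝[≥] 0 ×ˢ 𝓝[>] 0,
      (-Real.log (paramChoice t p q.1 q.2)) ^ (-p) ≤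
        K * max ((-Real.log q.1) ^ (-p)) (q.2 ^ (2 * p)) ∧
      paramChoice t p q.1 q.2 * (-Real.log (paramChoice t p q.1 q.2)) ^ (-p) ≤
        K * max q.1 (Real.exp (-(Real.pi ^ 2 / (16 * q.2 ^ 2)) * t) * q.2 ^ (2 * p + 1)) := by
  set c : ℝ := (Real.pi ^ 2 * t / 16) ^ (-p) with hc
  have hc0 : 0 < c := by positivity
  refine ⟨max (2 ^ p) c, lt_max_of_lt_right hc0, ?_⟩
  filter_upwards [tendsto_fst.eventually (eventually_log_neg_log_le hp),
    tendsto_fst.eventually self_mem_nhdsWithin, tendsto_snd.eventually self_mem_nhdsWithin,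
    tendsto_snd.eventually (Ioc_mem_nhdsGT one_pos)] with q hlog hε hη hη1
  obtain ⟨ε, η⟩ := q
  replace hε : 0 ≤ ε := hε
  replace hη : 0 < η := hη
  dsimp only at *
  have hα := paramChoice_pos t p ε hη
  have hK : 0 < max (2 ^ p) c := lt_max_of_lt_right hc0
  rcases max_choice (ε * (-Real.log ε) ^ p)
    (η * Real.exp (-(Real.pi ^ 2 / (16 * η ^ 2)) * t)) with h | h
  · have he : paramChoice t p ε η = ε * (-Real.log ε) ^ p := h
    have h0 : 0 < ε := by
      refine hε.lt_of_ne' fun h0 => ?_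
      rw [he, h0, zero_mul] at hα
      exact hα.false
    have hl : 0 < -Real.log ε := by linarith [(hlog h0).1]
    have hb := neg_log_rpow_le_of_mul_rpow hp h0 (hlog h0).1 (hlog h0).2
    rw [he]
    constructor
    · refine hb.trans (mul_le_mul (le_max_left _ _) (le_max_left _ _) (by positivity) hK.le)
    · calc _ ≤ ε * (-Real.log ε) ^ p * (2 ^ p * (-Real.log ε) ^ (-p)) := by gcongr
        _ = 2 ^ p * ε := by
          rw [Real.rpow_neg hl.le]
          field_simp
        _ ≤ _ := mul_le_mul (le_max_left _ _) (le_max_left _ _) hε hK.le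
  · have he : paramChoice t p ε η = η * Real.exp (-(Real.pi ^ 2 / (16 * η ^ 2)) * t) := h
    have hb := neg_log_rpow_le_of_mul_exp ht hp hη hη1.2
    rw [he]
    constructor
    · refine hb.trans (mul_le_mul (le_max_right _ _) (le_max_right _ _) (by positivity) hK.le)
    · calc _ ≤ η * Real.exp (-(Real.pi ^ 2 / (16 * η ^ 2)) * t) * (c * η ^ (2 * p)) := by gcongr
        _ = c * (Real.exp (-(Real.pi ^ 2 / (16 * η ^ 2)) * t) * η ^ (2 * p + 1)) := by
          rw [Real.rpow_add_one hη.ne']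
          ring
        _ ≤ _ := mul_le_mul (le_max_right _ _) (le_max_right _ _) (by positivity) hK.le

/-- Convergence rates for the parameter choice `paramChoice`. -/
theorem MemSobolev.exists_rate_paramChoice {t p : ℝ} (ht : 0 < t) (hp : 0 < p) {f : L2}
    (hf : MemSobolev p f) :
    ∃ K : ℝ, ∀ᶠ q : ℝ × ℝ in 𝓝[≥] 0 ×ˢ 𝓝[>] 0,
      ∀ ξ : L1, IsImpulsive q.1 q.2 ξ →
      ∀ fα : L2, IsTikhonovMin t ht (paramChoice t p q.1 q.2) (heatOp t ht f + ξ) fα →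
        ‖fα - f‖ ^ 2 ≤ K * max ((-Real.log q.1) ^ (-p)) (q.2 ^ (2 * p)) ∧
        ‖heatOp t ht fα - heatOp t ht f‖ ≤
          K * max q.1 (Real.exp (-(Real.pi ^ 2 / (16 * q.2 ^ 2)) * t) * q.2 ^ (2 * p + 1)) := by
  obtain ⟨C, hC, hbound⟩ := hf.exists_error_bound ht hp
  obtain ⟨K, hK, hlogα⟩ := exists_neg_log_paramChoice_le ht hp
  refine ⟨C * (2 + K), ?_⟩
  have hlt1 := (tendsto_paramChoice ht hp).eventually (Ioo_mem_nhdsGT one_pos)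
  filter_upwards [tendsto_fst.eventually (eventually_log_neg_log_le hp),
    tendsto_fst.eventually self_mem_nhdsWithin, tendsto_snd.eventually self_mem_nhdsWithin,
    tendsto_snd.eventually (Ioc_mem_nhdsGT one_half_pos), hlogα, hlt1]
    with q hlog hε hη hη1 hlogα hα1 ξ hξ fα hfα
  obtain ⟨ε, η⟩ := q
  replace hε : 0 ≤ ε := hε
  replace hη : 0 < η := hη
  dsimp only at *
  obtain ⟨hb1, hb2⟩ := hbound η ε _ hη hη1.2 hε hα1.1 hα1.2 ξ hξ fα hfα
  have hdiv := div_paramChoice_le t (η := η) hp hε fun h => (hlog h).1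
  have hle : η * Real.exp (-(Real.pi ^ 2 / (16 * η ^ 2)) * t) ≤ paramChoice t p ε η :=
    le_max_right _ _
  set α : ℝ := paramChoice t p ε η with hα
  set e : ℝ := Real.exp (-(Real.pi ^ 2 / (16 * η ^ 2)) * t) with he
  have hα0 : 0 < α := hα1.1
  have hee : Real.exp (-(Real.pi ^ 2 / (8 * η ^ 2)) * t) = e ^ 2 := by
    rw [he, ← Real.exp_nat_mul]
    congr 1
    push_cast
    field_simp
    norm_num
  rw [hee] at hb1 hb2
  have hr : η * e / α ≤ 1 := (div_le_one hα0).2 hle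
  have hr0 : 0 ≤ η * e / α := by positivity
  -- The middle term is `(η e / α)² η^{2p}`, and the second entry of the maximum makes `η e / α ≤
  -- 1`.
  have hB : η ^ 2 / α ^ 2 * (η ^ (2 * p) * e ^ 2) = (η * e / α) ^ 2 * η ^ (2 * p) := by
    field_simp
  rw [hB] at hb1 hb2
  have hηp : 0 < η ^ (2 * p) := by positivity
  constructor
  · refine hb1.trans ?_
    rw [mul_assoc]
    refine mul_le_mul_of_nonneg_left ?_ hC.le
    have h1 : (η * e / α) ^ 2 * η ^ (2 * p) ≤ η ^ (2 * p) :=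
      mul_le_of_le_one_left hηp.le (pow_le_one₀ hr0 hr)
    have h2 := le_max_left ((-Real.log ε) ^ (-p)) (η ^ (2 * p))
    have h3 := le_max_right ((-Real.log ε) ^ (-p)) (η ^ (2 * p))
    linarith [hlogα.1]
  · refine hb2.trans ?_
    rw [mul_assoc]
    refine mul_le_mul_of_nonneg_left ?_ hC.le
    have h1 : α * ((η * e / α) ^ 2 * η ^ (2 * p)) ≤ e * η ^ (2 * p + 1) := by
      calc α * ((η * e / α) ^ 2 * η ^ (2 * p)) = η * e / α * (e * (η ^ (2 * p) * η)) := by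
            field_simp
        _ ≤ 1 * (e * (η ^ (2 * p) * η)) := by gcongr
        _ = _ := by rw [one_mul, Real.rpow_add_one hη.ne']
    have h2 := le_max_left ε (e * η ^ (2 * p + 1))
    have h3 := le_max_right ε (e * η ^ (2 * p + 1))
    have h4 : α * (ε / α) = ε := by field_simp
    rw [mul_add, mul_add, h4]
    linarith [hlogα.2]

end HeatL1

theorem theorem4p2 (t : ℝ) (ht : 0 < t) (p : ℝ) (hp : 0 < p) :
    -- error bounds for every regularization parameter subject to the parameter condition
    (∀ fdag : L2, MemSobolev p fdag →
      ∃ C : ℝ, 0 < C ∧ ∃ η₀ : ℝ, 0 < η₀ ∧ ∀ Ce : ℝ, 0 < Ce →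
        -- `ω₁ η ε α` and `ω₂ η ε α` are the two terms `o(1)`
        ∃ ω₁ ω₂ : ℝ → ℝ → ℝ → ℝ,
          Tendsto (fun q : ℝ × ℝ × ℝ => ω₁ q.1 q.2.1 q.2.2)
            (𝓝[>] 0 ×ˢ 𝓝[≥] 0 ×ˢ 𝓝[>] 0) (𝓝 0) ∧
          Tendsto (fun q : ℝ × ℝ × ℝ => ω₂ q.1 q.2.1 q.2.2)
            (𝓝[>] 0 ×ˢ 𝓝[≥] 0 ×ˢ 𝓝[>] 0) (𝓝 0) ∧
          ∀ η ε α : ℝ, 0 < η → η ≤ η₀ → 0 ≤ ε → 0 < α → α < 1 → ParamCond t Ce ε η α →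
            ∀ ξ : L1, IsImpulsive ε η ξ →
            ∀ fα : L2, IsTikhonovMin t ht α (heatOp t ht fdag + ξ) fα →
              ‖fα - fdag‖ ^ 2 ≤
                C * (ε / α + η ^ 2 / α ^ 2 * Real.exp (-(Real.pi ^ 2 / (8 * η ^ 2)) * t)
                  + (-Real.log α) ^ (-p)) * (1 + ω₁ η ε α) ∧
              ‖heatOp t ht fα - heatOp t ht fdag‖ ≤
                C * (ε + η ^ 2 / α * Real.exp (-(Real.pi ^ 2 / (8 * η ^ 2)) * t)
                  + α * (-Real.log α) ^ (-p)) * (1 + ω₂ η ε α)) ∧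
    -- rates for an a priori choice `αbar ε η`, admissible and tending to `0`
    (∃ αbar : ℝ → ℝ → ℝ,
      Tendsto (fun q : ℝ × ℝ => αbar q.1 q.2) (𝓝[≥] 0 ×ˢ 𝓝[>] 0) (𝓝[>] 0) ∧
      (∃ Ce : ℝ, 0 < Ce ∧ ∀ᶠ q : ℝ × ℝ in 𝓝[≥] 0 ×ˢ 𝓝[>] 0,
        ParamCond t Ce q.1 q.2 (αbar q.1 q.2)) ∧
      ∀ fdag : L2, MemSobolev p fdag →
        ∃ K : ℝ, ∀ᶠ q : ℝ × ℝ in 𝓝[≥] 0 ×ˢ 𝓝[>] 0,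
          ∀ ξ : L1, IsImpulsive q.1 q.2 ξ →
          ∀ fα : L2, IsTikhonovMin t ht (αbar q.1 q.2) (heatOp t ht fdag + ξ) fα →
            -- for `ε = q.1 = 0` the term `(-log ε) ^ (-p)` is `0`, its limit as `ε → 0`
            ‖fα - fdag‖ ^ 2 ≤ K * max ((-Real.log q.1) ^ (-p)) (q.2 ^ (2 * p)) ∧
            ‖heatOp t ht fα - heatOp t ht fdag‖ ≤
              K * max q.1 (Real.exp (-(Real.pi ^ 2 / (16 * q.2 ^ 2)) * t)
                * q.2 ^ (2 * p + 1))) := by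
  refine ⟨fun fdag hf => ?_, paramChoice t p, tendsto_paramChoice ht hp,
    exists_paramCond_paramChoice ht hp, fun fdag hf => hf.exists_rate_paramChoice ht hp⟩
  obtain ⟨C, hC, hbound⟩ := hf.exists_error_bound ht hp
  -- The bound is non-asymptotic, so both `o(1)` terms can be `0`. The value `1/2` keeps the noise
  -- cut-off nonnegative and ensures `η^{2p} ≤ 1`.
  refine ⟨C, hC, 1 / 2, one_half_pos, fun Ce _ => ⟨fun _ _ _ => 0, fun _ _ _ => 0,
    tendsto_const_nhds, tendsto_const_nhds, fun η ε α hη hη' hε hα hα1 _ ξ hξ fα hfα => ?_⟩⟩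
  obtain ⟨h1, h2⟩ := hbound η ε α hη hη' hε hα hα1 ξ hξ fα hfα
  rw [add_zero, mul_one, mul_one]
  have hle : η ^ 2 / α ^ 2 * (η ^ (2 * p) * Real.exp (-(Real.pi ^ 2 / (8 * η ^ 2)) * t)) ≤
      η ^ 2 / α ^ 2 * Real.exp (-(Real.pi ^ 2 / (8 * η ^ 2)) * t) := by
    refine mul_le_mul_of_nonneg_left (mul_le_of_le_one_left (Real.exp_pos _).le ?_) (by positivity)
    exact Real.rpow_le_one hη.le (by linarith) (by linarith)
  constructor
  · refine h1.trans (mul_le_mul_of_nonneg_left ?_ hC.le)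
    linarith
  · refine h2.trans (mul_le_mul_of_nonneg_left ?_ hC.le)
    have h3 := mul_le_mul_of_nonneg_left hle hα.le
    have h4 : α * (ε / α) = ε := by field_simp
    have h5 : α * (η ^ 2 / α ^ 2 * Real.exp (-(Real.pi ^ 2 / (8 * η ^ 2)) * t)) =
        η ^ 2 / α * Real.exp (-(Real.pi ^ 2 / (8 * η ^ 2)) * t) := by field_simp
    rw [mul_add, mul_add, h4]
    linarith
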